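/- All Lie algebras are over $\mathbb{C}$; in each multiplication table below the products of basis elements not listed, and not obtained from listed ones by antisymmetry, are zero, and the same convention is used for the alternating bilinear maps $\varphi$. Consider the following solvable Lie algebras with basis $e_1,\dots,e_n,x$ (where $n=7,9,11$ in the last three cases). * $R(g^3_{(n,1)},1)$, for any $n\ge 7$: $[e_1,e_i]=e_{i+1}$ $(2\le i\le n-2)$; $[e_i,e_n]=e_{i+2}$ $(2\le i\le n-3)$; $[e_2,e_i]=e_{i+3}$ $(3\le i\le n-4)$; $[e_1,x]=e_1$; $[e_i,x]=(i+1)e_i$ $(2\le i\le n-1)$; $[e_n,x]=2e_n$. * $R(g^1_7,1)$: $[e_1,e_i]=e_{i+1}$ $(2\le i\le 5)$; $[e_2,e_i]=e_{i+2}$ $(i=3,4)$; $[e_i,e_{7-i}]=(-1)^ie_7$ $(i=2,3)$; $[e_i,x]=ie_i$ $(1\le i\le 7)$. * $R(g^2_9,1)$: $[e_1,e_i]=e_{i+1}$ $(2\le i\le 7)$; $[e_2,e_i]=e_{i+2}$ $(i=3,4)$; $[e_2,e_5]=3e_7$; $[e_2,e_6]=5e_8$; $[e_3,e_i]=-2e_{i+3}$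 $(i=4,5)$; $[e_i,e_{9-i}]=(-1)^ie_9$ $(2\le i\le 4)$; $[e_i,x]=ie_i$ $(1\le i\le 9)$. * $R(g^3_{11},1)$: $[e_1,e_i]=e_{i+1}$ $(2\le i\le 9)$; $[e_2,e_i]=e_{i+2}$ $(i=3,4)$; $[e_2,e_i]=-e_{i+2}$ $(i=6,7)$; $[e_3,e_7]=-e_{10}$; $[e_3,e_i]=e_{i+3}$ $(i=4,5)$; $[e_4,e_i]=e_{i+4}$ $(i=5,6)$; $[e_i,e_{11-i}]=(-1)^ie_{11}$ $(2\le i\le 5)$; $[e_i,x]=ie_i$ $(1\le i\le 11)$. **Theorem.** Let $R$ be a Lie algebra isomorphic to one of these algebras. Then the second Lie algebra cohomology space of $R$ with coefficients in the adjoint module has dimension $\dim H^2(R,R)=1$. Moreover, for each of the listed algebras the alternating bilinear map $\varphi$ below is a $2$-cocycle that is not a coboundary, so its class spans $H^2(R,R)$: * for $R(g^3_{(n,1)},1)$: $\varphi(e_1,e_n)=e_2$; $\varphi(e_i,e_n)=(i-3)e_{i+2}$ $(4\le i\le n-3)$; $\varphi(e_2,e_i)=\tfrac32(i-4)e_{i+3}$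 $(5\le i\le n-4)$; $\varphi(e_3,e_i)=-\tfrac32e_{i+4}$ $(4\le i\le n-5)$; * for $R(g^1_7,1)$: $\varphi(e_1,e_6)=e_7$, $\varphi(e_3,e_4)=e_7$; * for $R(g^2_9,1)$: $\varphi(e_1,e_2)=-9e_3$, $\varphi(e_1,e_8)=e_9$, $\varphi(e_2,e_5)=-12e_7$, $\varphi(e_2,e_6)=-24e_8$, $\varphi(e_2,e_7)=-9e_9$, $\varphi(e_3,e_4)=-6e_7$, $\varphi(e_3,e_5)=-6e_8$, $\varphi(e_3,e_6)=5e_9$, $\varphi(e_4,e_5)=-7e_9$; * for $R(g^3_{11},1)$: $\varphi(e_1,e_{10})=e_{11}$, $\varphi(e_2,e_5)=\tfrac34e_7$, $\varphi(e_2,e_6)=\tfrac32e_8$, $\varphi(e_2,e_7)=e_9$, $\varphi(e_2,e_8)=-\tfrac34e_{10}$, $\varphi(e_3,e_4)=-\tfrac34e_7$, $\varphi(e_3,e_5)=-\tfrac34e_8$, $\varphi(e_3,e_6)=\tfrac12e_9$, $\varphi(e_3,e_7)=\tfrac74e_{10}$, $\varphi(e_4,e_5)=-\tfrac54e_9$,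 $\varphi(e_4,e_6)=-\tfrac54e_{10}$, $\varphi(e_4,e_7)=-e_{11}$, $\varphi(e_5,e_6)=2e_{11}$. -/

import Mathlib

open LieModule.Cohomology

noncomputable section

/-- The space `Z²(L, M)` of Chevalley--Eilenberg `2`-cocycles, as a vector space in its own right. -/
def LieZ2 (K L M : Type*) [CommRing K] [LieRing L] [LieAlgebra K L]
    [AddCommGroup M] [Module K M] [LieRingModule L M] [LieModule K L M] : Type _ :=
  twoCocycle K L M

section

variable (K L M : Type*) [CommRing K] [LieRing L] [LieAlgebra K L]
    [AddCommGroup M] [Module K M] [LieRingModule L M] [LieModule K L M]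

instance : AddCommGroup (LieZ2 K L M) :=
  @Submodule.addCommGroup K (twoCochain K L M) _ (Submodule.addCommGroup _) _ (twoCocycle K L M)

instance : Module K (LieZ2 K L M) := Submodule.module (twoCocycle K L M)

/-- The coboundary operator from `1`-cochains to `2`-cocycles. -/
def lieD12 : oneCochain K L M →ₗ[K] LieZ2 K L M :=
  (d₁₂ K L M).codRestrict (twoCocycle K L M) fun f =>
    (mem_twoCocycle_iff K L M _).2 (LinearMap.congr_fun (d₂₃_comp_d₁₂ K L M) f)

/-- The second Chevalley--Eilenberg cohomology space `H²(L, M) = Z²(L, M) / B²(L, M)`. -/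
abbrev LieH2 : Type _ := LieZ2 K L M ⧸ LinearMap.range (lieD12 K L M)

end

/-- The vector `v_k` of the standard basis `v_0, …, v_n` of `ℂ^{n+1}`; it is `0` for `k > n`. -/
def stdVec (n k : ℕ) : Fin (n + 1) → ℂ :=
  if hk : k < n + 1 then Pi.single ⟨k, hk⟩ 1 else 0

/-- The bilinear map on `ℂ^{n+1}` with `(v_i, v_j) ↦ c i j • v_{i+j}`. -/
def gradedBilin (n : ℕ) (c : ℕ → ℕ → ℂ) :
    (Fin (n + 1) → ℂ) →ₗ[ℂ] (Fin (n + 1) → ℂ) →ₗ[ℂ] (Fin (n + 1) → ℂ) :=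
  (Pi.basisFun ℂ (Fin (n + 1))).constr ℂ fun i =>
    (Pi.basisFun ℂ (Fin (n + 1))).constr ℂ fun j => c i j • stdVec n (i + j)

theorem stdVec_of_lt {n k : ℕ} (hk : n < k) : stdVec n k = 0 := by
  simp [stdVec]; omega

theorem stdVec_fin {n : ℕ} (i : Fin (n + 1)) :
    stdVec n i = Pi.basisFun ℂ (Fin (n + 1)) i := by
  simp only [stdVec, dif_pos i.2, Pi.basisFun_apply]

theorem gradedBilin_stdVec (n : ℕ) (c : ℕ → ℕ → ℂ) (i j : ℕ) :
    gradedBilin n c (stdVec n i) (stdVec n j) = c i j • stdVec n (i + j) := by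
  by_cases hi : i < n + 1
  · by_cases hj : j < n + 1
    · have h1 := stdVec_fin (⟨i, hi⟩ : Fin (n + 1))
      have h2 := stdVec_fin (⟨j, hj⟩ : Fin (n + 1))
      simp only at h1 h2
      rw [h1, h2, gradedBilin, Module.Basis.constr_basis, Module.Basis.constr_basis]
    · rw [stdVec_of_lt (k := j) (by omega), stdVec_of_lt (k := i + j) (by omega)]
      simp
  · rw [stdVec_of_lt (k := i) (by omega), stdVec_of_lt (k := i + j) (by omega)]
    simp

theorem gradedBilin_skew (n : ℕ) (c : ℕ → ℕ → ℂ) (hc : ∀ i j, c i j = -c j i)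
    (u w : Fin (n + 1) → ℂ) : gradedBilin n c u w = -gradedBilin n c w u := by
  have h : gradedBilin n c = -(gradedBilin n c).flip := by
    refine (Pi.basisFun ℂ (Fin (n + 1))).ext fun i =>
      (Pi.basisFun ℂ (Fin (n + 1))).ext fun j => ?_
    simp only [LinearMap.neg_apply, LinearMap.flip_apply]
    rw [← stdVec_fin, ← stdVec_fin, gradedBilin_stdVec, gradedBilin_stdVec, hc,
      add_comm (i : ℕ) (j : ℕ), neg_smul]
  exact congrArg (fun B => B u w) h

theorem gradedBilin_self (n : ℕ) (c : ℕ → ℕ → ℂ) (hc : ∀ i j, c i j = -c j i)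
    (u : Fin (n + 1) → ℂ) : gradedBilin n c u u = 0 := by
  have h := gradedBilin_skew n c hc u u
  rwa [eq_neg_iff_add_eq_zero, ← two_smul ℂ, smul_eq_zero_iff_right two_ne_zero] at h

/-- A multiplication table for a Lie algebra with basis `v_0, …, v_n` graded by the index:
`half i j` is the coefficient of `v_{i+j}` contributed by a product `[v_i, v_j]` in the list of
nonzero products (each listed once), where `v_k = 0` for `k > n`. The products `[v_j, v_i]` are
then given by antisymmetry, and products that are not listed vanish. -/
structure GradedTable where
  n : ℕ
  half : ℕ → ℕ → ℤ
  jacobi : ∀ i < n + 1, ∀ j < n + 1, ∀ k < n + 1, i + j + k ≤ n →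
    (half j k - half k j) * (half i (j + k) - half (j + k) i) +
    (half k i - half i k) * (half j (k + i) - half (k + i) j) +
    (half i j - half j i) * (half k (i + j) - half (i + j) k) = 0

namespace GradedTable

/-- The antisymmetrized structure constants: `[v_i, v_j] = coeff i j • v_{i+j}`. -/
def coeff (T : GradedTable) (i j : ℕ) : ℂ := ((T.half i j - T.half j i : ℤ) : ℂ)

/-- The complex Lie algebra with multiplication table `T`. -/
def Alg (T : GradedTable) : Type := Fin (T.n + 1) → ℂ

instance (T : GradedTable) : AddCommGroup T.Alg :=
  inferInstanceAs (AddCommGroup (Fin (T.n + 1) → ℂ))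

instance (T : GradedTable) : Module ℂ T.Alg :=
  inferInstanceAs (Module ℂ (Fin (T.n + 1) → ℂ))

/-- The basis vector `v_k` (zero for `k > n`). -/
def v (T : GradedTable) (k : ℕ) : T.Alg := stdVec T.n k

/-- The bilinear map with `(v_i, v_j) ↦ c i j • v_{i+j}`. -/
def bilin (T : GradedTable) (c : ℕ → ℕ → ℂ) : T.Alg →ₗ[ℂ] T.Alg →ₗ[ℂ] T.Alg :=
  gradedBilin T.n c

theorem bilin_v (T : GradedTable) (c : ℕ → ℕ → ℂ) (i j : ℕ) :
    T.bilin c (T.v i) (T.v j) = c i j • T.v (i + j) := gradedBilin_stdVec _ _ _ _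

theorem coeff_skew (T : GradedTable) (i j : ℕ) : T.coeff i j = -T.coeff j i := by
  simp [coeff]

theorem coeff_jacobi (T : GradedTable) (i j k : Fin (T.n + 1)) (h : (i + j + k : ℕ) ≤ T.n) :
    T.coeff j k * T.coeff i (j + k) =
      T.coeff i j * T.coeff (i + j) k + T.coeff i k * T.coeff j (i + k) := by
  have h1 := T.jacobi i i.2 j j.2 k k.2 h
  have h2 := congrArg (Int.cast : ℤ → ℂ) h1
  rw [add_comm (k : ℕ) i] at h2
  simp only [coeff]
  push_cast at h2 ⊢
  linear_combination h2

theorem bilin_leibniz (T : GradedTable) (a b d : T.Alg) :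
    T.bilin T.coeff a (T.bilin T.coeff b d) =
      T.bilin T.coeff (T.bilin T.coeff a b) d + T.bilin T.coeff b (T.bilin T.coeff a d) := by
  let B := T.bilin T.coeff
  let e : Module.Basis (Fin (T.n + 1)) ℂ T.Alg := Pi.basisFun ℂ (Fin (T.n + 1))
  have he : ∀ i, e i = T.v i := fun i => (stdVec_fin i).symm
  have key : ∀ i j k : Fin (T.n + 1), B (e i) (B (e j) (e k)) =
      B (B (e i) (e j)) (e k) + B (e j) (B (e i) (e k)) := by
    intro i j k
    simp only [B, he, bilin_v, map_smul, LinearMap.smul_apply, smul_smul]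
    have e1 : (j : ℕ) + (i + k) = i + (j + k) := by omega
    have e2 : (i : ℕ) + j + k = i + (j + k) := by omega
    rw [e1, e2, ← add_smul]
    by_cases h : (i + j + k : ℕ) ≤ T.n
    · rw [coeff_jacobi T i j k h]
    · have : T.v (i + (j + k)) = 0 := stdVec_of_lt (by omega)
      rw [this, smul_zero, smul_zero]
  have h1 : ∀ i j : Fin (T.n + 1), B (e i) (B (e j) d) =
      B (B (e i) (e j)) d + B (e j) (B (e i) d) := by
    intro i j
    have : (B (e i)).comp (B (e j)) = B (B (e i) (e j)) + (B (e j)).comp (B (e i)) :=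
      e.ext fun k => key i j k
    exact congrArg (fun F => F d) this
  have h2 : ∀ i : Fin (T.n + 1), B (e i) (B b d) = B (B (e i) b) d + B b (B (e i) d) := by
    intro i
    have : (B (e i)).comp (B.flip d) = (B.flip d).comp (B (e i)) + B.flip (B (e i) d) :=
      e.ext fun j => h1 i j
    exact congrArg (fun F => F b) this
  have : B.flip (B b d) = (B.flip d).comp (B.flip b) + (B b).comp (B.flip d) :=
    e.ext fun i => h2 i
  exact congrArg (fun F => F a) this

instance (T : GradedTable) : LieRing T.Alg where
  bracket a b := T.bilin T.coeff a b
  add_lie a b d := by simp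
  lie_add a b d := by simp
  lie_self a := gradedBilin_self T.n _ T.coeff_skew a
  leibniz_lie a b d := T.bilin_leibniz a b d

instance (T : GradedTable) : LieAlgebra ℂ T.Alg where
  lie_smul t a b := map_smul (T.bilin T.coeff a) t b

theorem lie_v (T : GradedTable) (i j : ℕ) : ⁅T.v i, T.v j⁆ = T.coeff i j • T.v (i + j) :=
  T.bilin_v _ i j

/-- The alternating bilinear map whose list of nonzero values is
`(v_i, v_j) ↦ p i j • v_{i+j}` (each unordered pair listed once). -/
def cochain (T : GradedTable) (p : ℕ → ℕ → ℚ) : twoCochain ℂ T.Alg T.Alg :=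
  ⟨T.bilin fun i j => ((p i j - p j i : ℚ) : ℂ),
    fun a => gradedBilin_self T.n _ (fun i j => by simp) a⟩

theorem cochain_v (T : GradedTable) (p : ℕ → ℕ → ℚ) (i j : ℕ) :
    T.cochain p (T.v i) (T.v j) = ((p i j - p j i : ℚ) : ℂ) • T.v (i + j) :=
  T.bilin_v (fun i j => ((p i j - p j i : ℚ) : ℂ)) i j

end GradedTable

/-! In each of the following tables `v_0` is the element `x` of the complement of the nilradical. -/

set_option maxHeartbeats 4000000 in
/-- The algebra `R(g³_{(n,1)}, 1)` with basis `e_1, …, e_n, x`. The grading index of `x` is `0`,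
that of `e_1` is `1`, that of `e_n` is `2`, and that of `e_i` is `i + 1` for `2 ≤ i ≤ n - 1`. The
upper bounds on indices in the multiplication table come from `v_k = 0` for `k > n`; the table in
terms of the `e_i` is spelled out in the lemmas below. -/
def Rg3 (n : ℕ) : GradedTable where
  n := n
  half i j :=
    if j = 0 then i
    else if i = 1 ∧ 3 ≤ j then 1
    else if 3 ≤ i ∧ j = 2 then 1
    else if i = 3 ∧ 4 ≤ j then 1
    else 0
  jacobi := by
    intro i _ j _ k _ _
    have e : ∀ i : ℕ, i = 0 ∨ i = 1 ∨ i = 2 ∨ i = 3 ∨ ∃ m, i = m + 4 := fun i => by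
      rcases i with _ | _ | _ | _ | i <;> simp
    obtain rfl | rfl | rfl | rfl | ⟨i, rfl⟩ := e i <;>
    obtain rfl | rfl | rfl | rfl | ⟨j, rfl⟩ := e j <;>
    obtain rfl | rfl | rfl | rfl | ⟨k, rfl⟩ := e k <;>
    simp <;> (try split_ifs) <;> (try omega) <;> (try ring_nf)

/-- The algebra `R(g¹_7, 1)`; here `v_i = e_i` for `1 ≤ i ≤ 7`. -/
def Rg7 : GradedTable where
  n := 7
  half i j :=
    if j = 0 then i
    else if i = 1 ∧ 2 ≤ j ∧ j ≤ 5 then 1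
    else if i = 2 ∧ 3 ≤ j ∧ j ≤ 4 then 1
    else if 2 ≤ i ∧ i ≤ 3 ∧ i + j = 7 then (-1) ^ i
    else 0
  jacobi := by decide +kernel

/-- The algebra `R(g²_9, 1)`; here `v_i = e_i` for `1 ≤ i ≤ 9`. -/
def Rg9 : GradedTable where
  n := 9
  half i j :=
    if j = 0 then i
    else if i = 1 ∧ 2 ≤ j ∧ j ≤ 7 then 1
    else if i = 2 ∧ 3 ≤ j ∧ j ≤ 4 then 1
    else if i = 2 ∧ j = 5 then 3
    else if i = 2 ∧ j = 6 then 5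
    else if i = 3 ∧ 4 ≤ j ∧ j ≤ 5 then -2
    else if 2 ≤ i ∧ i ≤ 4 ∧ i + j = 9 then (-1) ^ i
    else 0
  jacobi := by decide +kernel

/-- The algebra `R(g³_11, 1)`; here `v_i = e_i` for `1 ≤ i ≤ 11`. -/
def Rg11 : GradedTable where
  n := 11
  half i j :=
    if j = 0 then i
    else if i = 1 ∧ 2 ≤ j ∧ j ≤ 9 then 1
    else if i = 2 ∧ 3 ≤ j ∧ j ≤ 4 then 1
    else if i = 2 ∧ 6 ≤ j ∧ j ≤ 7 then -1
    else if i = 3 ∧ j = 7 then -1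
    else if i = 3 ∧ 4 ≤ j ∧ j ≤ 5 then 1
    else if i = 4 ∧ 5 ≤ j ∧ j ≤ 6 then 1
    else if 2 ≤ i ∧ i ≤ 5 ∧ i + j = 11 then (-1) ^ i
    else 0
  jacobi := by decide +kernel

/-- The grading index of `e_i` in `R(g³_{(n,1)}, 1)`. -/
def rg3Weight (n i : ℕ) : ℕ := if i = 1 then 1 else if i = n then 2 else i + 1

/-- The basis vector `e_i` of `R(g³_{(n,1)}, 1)`, for `1 ≤ i ≤ n`. -/
def rg3E (n i : ℕ) : (Rg3 n).Alg := (Rg3 n).v (rg3Weight n i)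

/-- The list of nonzero values of the cochain on `R(g³_{(n,1)}, 1)`, in terms of grading
indices; the values on the `e_i` are spelled out in the lemma `rg3Cochain_e` below. -/
def rg3Values (i j : ℕ) : ℚ :=
  if i = 1 ∧ j = 2 then 1
  else if 5 ≤ i ∧ j = 2 then i - 4
  else if i = 3 ∧ 6 ≤ j then 3 / 2 * (j - 5)
  else if i = 4 ∧ 5 ≤ j then -3 / 2
  else 0

/-- The list of nonzero values of the cochain on `R(g¹_7, 1)`. -/
def rg7Values : ℕ → ℕ → ℚ
  | 1, 6 => 1
  | 3, 4 => 1
  | _, _ => 0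

/-- The list of nonzero values of the cochain on `R(g²_9, 1)`. -/
def rg9Values : ℕ → ℕ → ℚ
  | 1, 2 => -9
  | 1, 8 => 1
  | 2, 5 => -12
  | 2, 6 => -24
  | 2, 7 => -9
  | 3, 4 => -6
  | 3, 5 => -6
  | 3, 6 => 5
  | 4, 5 => -7
  | _, _ => 0

/-- The list of nonzero values of the cochain on `R(g³_11, 1)`. -/
def rg11Values : ℕ → ℕ → ℚ
  | 1, 10 => 1
  | 2, 5 => 3 / 4
  | 2, 6 => 3 / 2
  | 2, 7 => 1
  | 2, 8 => -3 / 4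
  | 3, 4 => -3 / 4
  | 3, 5 => -3 / 4
  | 3, 6 => 1 / 2
  | 3, 7 => 7 / 4
  | 4, 5 => -5 / 4
  | 4, 6 => -5 / 4
  | 4, 7 => -1
  | 5, 6 => 2
  | _, _ => 0

/-- The products of `R(g³_{(n,1)}, 1)` in the basis `e_1, …, e_n, x = v_0`. -/
theorem rg3_lie_e {n : ℕ} (hn : 7 ≤ n) {i j : ℕ} (hi : 1 ≤ i) (hij : i < j) (hj : j ≤ n) :
    ⁅rg3E n i, rg3E n j⁆ =
      if i = 1 ∧ 2 ≤ j ∧ j ≤ n - 2 then rg3E n (j + 1)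
      else if 2 ≤ i ∧ i ≤ n - 3 ∧ j = n then rg3E n (i + 2)
      else if i = 2 ∧ 3 ≤ j ∧ j ≤ n - 4 then rg3E n (j + 3)
      else 0 := by
  have hz : ∀ k, n < k → (Rg3 n).v k = 0 := fun k hk => stdVec_of_lt hk
  have he : ∀ k, 2 ≤ k → k < n → rg3E n k = (Rg3 n).v (k + 1) := fun k h2 hk => by
    rw [rg3E, rg3Weight, if_neg (by omega), if_neg (by omega)]
  have he1 : rg3E n 1 = (Rg3 n).v 1 := by rw [rg3E, rg3Weight, if_pos rfl]
  have hen : rg3E n n = (Rg3 n).v 2 := by rw [rg3E, rg3Weight, if_neg (by omega), if_pos rfl]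
  rcases Nat.lt_or_ge 1 i with h1 | h1
  · rw [if_neg (by omega)]
    rcases Nat.lt_or_ge j n with h2 | h2
    · rw [if_neg (by omega), he i (by omega) (by omega), he j (by omega) (by omega),
        GradedTable.lie_v]
      by_cases h3 : i = 2
      · subst h3
        have hc : (Rg3 n).coeff (2 + 1) (j + 1) = 1 := by
          simp [GradedTable.coeff, Rg3]; grind
        rw [hc, one_smul]
        by_cases h4 : j ≤ n - 4
        · rw [if_pos (by omega), he (j + 3) (by omega) (by omega)]
          congr 1; omega
        · rw [if_neg (by omega), hz _ (by omega)]
      · have hc : (Rg3 n).coeff (i + 1) (j + 1) = 0 := by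
          simp [GradedTable.coeff, Rg3]; grind
        rw [hc, zero_smul, if_neg (by omega)]
    · obtain rfl : j = n := by omega
      have hc : (Rg3 j).coeff (i + 1) 2 = 1 := by
        simp [GradedTable.coeff, Rg3]; grind
      rw [hen, he i (by omega) (by omega), GradedTable.lie_v, hc, one_smul]
      by_cases h4 : i ≤ j - 3
      · rw [if_pos (by omega), he (i + 2) (by omega) (by omega)]
      · rw [if_neg (by omega), if_neg (by omega), hz _ (by omega)]
  · obtain rfl : i = 1 := by omega
    rcases Nat.lt_or_ge j n with h2 | h2
    · have hc : (Rg3 n).coeff 1 (j + 1) = 1 := by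
        simp [GradedTable.coeff, Rg3]; grind
      rw [he1, he j (by omega) (by omega), GradedTable.lie_v, hc, one_smul]
      by_cases h4 : j ≤ n - 2
      · rw [if_pos (by omega), he (j + 1) (by omega) (by omega)]
        congr 1; omega
      · rw [if_neg (by omega), if_neg (by omega), if_neg (by omega), hz _ (by omega)]
    · obtain rfl : j = n := by omega
      rw [he1, hen, GradedTable.lie_v, if_neg (by omega), if_neg (by omega), if_neg (by omega)]
      have hc : (Rg3 j).coeff 1 2 = 0 := by simp [GradedTable.coeff, Rg3]
      rw [hc, zero_smul]

/-- The action of `x = v_0` on `R(g³_{(n,1)}, 1)`. -/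
theorem rg3_lie_x (n i : ℕ) :
    ⁅rg3E n i, (Rg3 n).v 0⁆ =
      (if i = 1 then 1 else if i = n then 2 else (i + 1 : ℂ)) • rg3E n i := by
  rw [rg3E, GradedTable.lie_v, add_zero]
  congr 1
  have hc : ∀ w, (Rg3 n).coeff w 0 = w := by
    intro w
    rcases w with _ | w <;> simp [GradedTable.coeff, Rg3]
  rw [hc, rg3Weight]
  split_ifs <;> push_cast <;> rfl

/-- The values of the cochain of `rg3Values` on the `e_i`. -/
theorem rg3Cochain_e {n : ℕ} (hn : 7 ≤ n) {i j : ℕ} (hi : 1 ≤ i) (hij : i < j) (hj : j ≤ n) :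
    (Rg3 n).cochain rg3Values (rg3E n i) (rg3E n j) =
      if i = 1 ∧ j = n then rg3E n 2
      else if 4 ≤ i ∧ i ≤ n - 3 ∧ j = n then (i - 3 : ℂ) • rg3E n (i + 2)
      else if i = 2 ∧ 5 ≤ j ∧ j ≤ n - 4 then (3 / 2 * (j - 4) : ℂ) • rg3E n (j + 3)
      else if i = 3 ∧ 4 ≤ j ∧ j ≤ n - 5 then (-3 / 2 : ℂ) • rg3E n (j + 4)
      else 0 := by
  have hz : ∀ k, n < k → (Rg3 n).v k = 0 := fun k hk => stdVec_of_lt hk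
  have he : ∀ k, 2 ≤ k → k < n → rg3E n k = (Rg3 n).v (k + 1) := fun k h2 hk => by
    rw [rg3E, rg3Weight, if_neg (by omega), if_neg (by omega)]
  have he1 : rg3E n 1 = (Rg3 n).v 1 := by rw [rg3E, rg3Weight, if_pos rfl]
  have hen : rg3E n n = (Rg3 n).v 2 := by rw [rg3E, rg3Weight, if_neg (by omega), if_pos rfl]
  rcases Nat.lt_or_ge 1 i with h1 | h1
  · rw [if_neg (by omega)]
    rcases Nat.lt_or_ge j n with h2 | h2
    · rw [if_neg (by omega), he i (by omega) (by omega), he j (by omega) (by omega),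
        GradedTable.cochain_v]
      by_cases h3 : i = 2
      · subst h3
        rw [if_neg (by omega : ¬(2 = 3 ∧ _))]
        by_cases h5 : 5 ≤ j
        · have hc : rg3Values (2 + 1) (j + 1) - rg3Values (j + 1) (2 + 1) = 3 / 2 * (j - 4) := by
            simp [rg3Values]; grind
          rw [hc]
          by_cases h4 : j ≤ n - 4
          · rw [if_pos (by omega), he (j + 3) (by omega) (by omega)]
            push_cast
            congr 2; omega
          · rw [if_neg (by omega), hz _ (by omega), smul_zero]
        · have hc : rg3Values (2 + 1) (j + 1) - rg3Values (j + 1) (2 + 1) = 0 := by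
            simp [rg3Values]; grind
          rw [hc, if_neg (by omega), Rat.cast_zero, zero_smul]
      · rw [if_neg (by omega)]
        by_cases h5 : i = 3
        · subst h5
          have hc : rg3Values (3 + 1) (j + 1) - rg3Values (j + 1) (3 + 1) = -3 / 2 := by
            simp [rg3Values]; grind
          rw [hc]
          by_cases h4 : j ≤ n - 5
          · rw [if_pos (by omega), he (j + 4) (by omega) (by omega)]
            push_cast
            congr 2; omega
          · rw [if_neg (by omega), hz _ (by omega), smul_zero]
        · have hc : rg3Values (i + 1) (j + 1) - rg3Values (j + 1) (i + 1) = 0 := by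
            simp [rg3Values]; grind
          rw [hc, if_neg (by omega), Rat.cast_zero, zero_smul]
    · obtain rfl : j = n := by omega
      rw [if_neg (by omega : ¬(i = 2 ∧ _)), if_neg (by omega : ¬(i = 3 ∧ _)),
        hen, he i (by omega) (by omega), GradedTable.cochain_v]
      by_cases h5 : 4 ≤ i
      · have hc : rg3Values (i + 1) 2 - rg3Values 2 (i + 1) = i - 3 := by
          simp [rg3Values]; grind
        rw [hc]
        by_cases h4 : i ≤ j - 3
        · rw [if_pos (by omega), he (i + 2) (by omega) (by omega)]
          push_cast
          rfl
        · rw [if_neg (by omega), hz _ (by omega), smul_zero]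
      · have hc : rg3Values (i + 1) 2 - rg3Values 2 (i + 1) = 0 := by
          simp [rg3Values]; grind
        rw [hc, if_neg (by omega), Rat.cast_zero, zero_smul]
  · obtain rfl : i = 1 := by omega
    rcases Nat.lt_or_ge j n with h2 | h2
    · have hc : rg3Values 1 (j + 1) - rg3Values (j + 1) 1 = 0 := by
        simp [rg3Values]; grind
      rw [he1, he j (by omega) (by omega), GradedTable.cochain_v, hc, if_neg (by omega),
        if_neg (by omega), if_neg (by omega), if_neg (by omega), Rat.cast_zero, zero_smul]
    · obtain rfl : j = n := by omega
      rw [if_pos (by omega), he1, hen, he 2 (by omega) (by omega), GradedTable.cochain_v]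
      simp [rg3Values]

end

/-! In each algebra `x = v_0` acts diagonally with `[v_i, x] = i v_i`, so everything is graded by
weight. Since `x` acts trivially on cohomology, only cochains of degree `0` matter: by Cartan's
formula, `d` of the contraction of a cocycle with `x` multiplies its components by their weight
defects, and dividing by the nonzero defects gives a primitive of all but the degree `0` part
(`exists_homCochain_of_mem_twoCocycle`). All weights are simple, so a degree `0` cochain is a scalar
table `C i j` with `(v_i, v_j) ↦ C i j • v_{i+j}`, degree `0` coboundaries come from diagonal maps
`v_i ↦ a_i v_i`, and the cocycle condition is a linear system on `C`.

In each algebra there is a pair `(i₀, j₀)` with `[v_{i₀}, v_{j₀}] = 0`, namely `(e_1, e_n)` for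
`Rg3` and `(e_1, e_{n-1})` for the other three. The entry `C i₀ j₀` vanishes on coboundaries but not
on the given cocycle. Conversely, if a degree `0` cocycle has `C i₀ j₀ = 0`, a diagonal coboundary
clears the entries on generators of the nilradical, and the cocycle identities then force the rest
to vanish (`Rg3_cocycle_eq_zero` and its analogues). Hence this entry is a coordinate on the
one-dimensional `H²`. -/

noncomputable section

/-! ### Degree `0` cochains and diagonal coboundaries -/

namespace GradedTable

variable (T : GradedTable)

/-- The standard basis `v_0, …, v_n`. -/
def basis : Module.Basis (Fin (T.n + 1)) ℂ T.Alg := Pi.basisFun ℂ (Fin (T.n + 1))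

theorem basis_apply (i : Fin (T.n + 1)) : T.basis i = T.v i := (stdVec_fin i).symm

theorem v_of_lt {k : ℕ} (hk : T.n < k) : T.v k = 0 := stdVec_of_lt hk

/-- The coordinate of index `k` (zero for `k > n`). -/
def coord (k : ℕ) : T.Alg →ₗ[ℂ] ℂ :=
  if hk : k < T.n + 1 then T.basis.coord ⟨k, hk⟩ else 0

theorem coord_v (j k : ℕ) (hk : k ≤ T.n) : T.coord k (T.v j) = if j = k then 1 else 0 := by
  rw [coord, dif_pos (by omega)]
  by_cases hj : j < T.n + 1
  · have := T.basis_apply ⟨j, hj⟩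
    simp only at this
    rw [← this, Module.Basis.coord_apply, Module.Basis.repr_self, Finsupp.single_apply]
    simp
  · rw [T.v_of_lt (by omega), map_zero, if_neg (by omega)]

theorem coord_smul_v (j k : ℕ) : T.coord k (T.v j) • T.v k = if j = k then T.v k else 0 := by
  by_cases hk : k ≤ T.n
  · rw [T.coord_v j k hk, ite_smul, one_smul, zero_smul]
  · rw [T.v_of_lt (k := k) (by omega), smul_zero, ite_self]

theorem coord_lie_v (i j : ℕ) (hij : i + j ≤ T.n) (u : T.Alg) :
    T.coord (i + j) ⁅T.v i, u⁆ = T.coeff i j * T.coord j u := by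
  have : T.coord (i + j) ∘ₗ T.bilin T.coeff (T.v i) = T.coeff i j • T.coord j := by
    refine T.basis.ext fun k => ?_
    simp only [LinearMap.comp_apply, LinearMap.smul_apply, basis_apply, bilin_v, map_smul,
      T.coord_v _ _ hij, T.coord_v _ _ (show j ≤ T.n by omega), add_right_inj, smul_eq_mul]
    split_ifs with h
    · rw [h]
    · simp
  exact LinearMap.congr_fun this u

/-- The homogeneous bilinear map of degree `0` with coefficients `C`, as an alternating map. -/
def homCochain (C : ℕ → ℕ → ℂ) (hC : ∀ i j, C i j = -C j i) : twoCochain ℂ T.Alg T.Alg :=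
  ⟨T.bilin C, fun a => gradedBilin_self T.n C hC a⟩

theorem homCochain_v (C : ℕ → ℕ → ℂ) (hC : ∀ i j, C i j = -C j i) (i j : ℕ) :
    T.homCochain C hC (T.v i) (T.v j) = C i j • T.v (i + j) := T.bilin_v C i j

variable {T} in
theorem twoCochain_ext {φ ψ : twoCochain ℂ T.Alg T.Alg}
    (h : ∀ i ≤ T.n, ∀ j ≤ T.n, φ (T.v i) (T.v j) = ψ (T.v i) (T.v j)) : φ = ψ := by
  apply Subtype.ext
  refine T.basis.ext fun i => T.basis.ext fun j => ?_
  rw [T.basis_apply, T.basis_apply]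
  exact h i (by omega) j (by omega)

/-- The cocycle identity for the coefficients of a homogeneous cochain of degree `0`. -/
def IsCocycle (C : ℕ → ℕ → ℂ) : Prop :=
  ∀ i j k, i + j + k ≤ T.n →
    T.coeff i (j + k) * C j k + T.coeff j (k + i) * C k i + T.coeff k (i + j) * C i j +
      (C i (j + k) * T.coeff j k + C j (k + i) * T.coeff k i + C k (i + j) * T.coeff i j) = 0

theorem d₂₃_homCochain_v (C : ℕ → ℕ → ℂ) (hC : ∀ i j, C i j = -C j i) (i j k : ℕ) :
    d₂₃ ℂ T.Alg T.Alg (T.homCochain C hC) (T.v i) (T.v j) (T.v k) =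
      (T.coeff i (j + k) * C j k + T.coeff j (k + i) * C k i + T.coeff k (i + j) * C i j +
      (C i (j + k) * T.coeff j k + C j (k + i) * T.coeff k i + C k (i + j) * T.coeff i j)) •
        T.v (i + j + k) := by
  simp only [d₂₃_apply, lie_v, homCochain_v, lie_smul, map_smul, LinearMap.smul_apply, smul_smul]
  rw [show j + (i + k) = i + j + k by omega, show k + (i + j) = i + j + k by omega,
    show i + (j + k) = i + j + k by omega, show i + k + j = i + j + k by omega,
    show j + k + i = i + j + k by omega]
  simp only [← sub_smul, ← add_smul]
  congr 1
  rw [hC k i, T.coeff_skew k i, hC i (j + k), hC j (k + i), hC k (i + j), add_comm k i]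
  ring

theorem homCochain_mem_twoCocycle_iff (C : ℕ → ℕ → ℂ) (hC : ∀ i j, C i j = -C j i) :
    T.homCochain C hC ∈ twoCocycle ℂ T.Alg T.Alg ↔ T.IsCocycle C := by
  rw [mem_twoCocycle_iff]
  constructor
  · intro h i j k hijk
    have h1 := T.d₂₃_homCochain_v C hC i j k
    rw [h] at h1
    have h2 := congrArg (T.coord (i + j + k)) h1
    rw [map_smul, T.coord_v _ _ hijk, if_pos rfl, smul_eq_mul, mul_one] at h2
    simpa using h2.symm
  · intro h
    refine T.basis.ext fun i => T.basis.ext fun j => T.basis.ext fun k => ?_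
    simp only [T.basis_apply, LinearMap.zero_apply]
    rw [d₂₃_homCochain_v]
    by_cases hijk : (i + j + k : ℕ) ≤ T.n
    · rw [h i j k hijk, zero_smul]
    · rw [T.v_of_lt (by omega), smul_zero]

/-- The coefficients of the coboundary of the diagonal map `v_i ↦ a_i • v_i`. -/
def diagCoboundary (a : ℕ → ℂ) (i j : ℕ) : ℂ := T.coeff i j * (a i + a j - a (i + j))

theorem diagCoboundary_skew (a : ℕ → ℂ) (i j : ℕ) :
    T.diagCoboundary a i j = -T.diagCoboundary a j i := by
  rw [diagCoboundary, diagCoboundary, T.coeff_skew, add_comm i j]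
  ring

/-- In each cyclic pair of terms the inner `a (j + k)` cancels, leaving the common factor `a i + a j
+ a k - a (i + j + k)` times the Jacobi identity. -/
theorem isCocycle_diagCoboundary (a : ℕ → ℂ) : T.IsCocycle (T.diagCoboundary a) := by
  intro i j k h
  have := T.coeff_jacobi ⟨i, by omega⟩ ⟨j, by omega⟩ ⟨k, by omega⟩ h
  simp only at this
  simp only [diagCoboundary]
  rw [show i + (j + k) = i + j + k by omega, show j + (k + i) = i + j + k by omega,
    show k + (i + j) = i + j + k by omega, T.coeff_skew k i, T.coeff_skew k (i + j), add_comm k i]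
  linear_combination (a i + a j + a k - a (i + j + k)) * this

variable {T} in
theorem IsCocycle.sub {C D : ℕ → ℕ → ℂ} (hC : T.IsCocycle C) (hD : T.IsCocycle D) :
    T.IsCocycle fun i j => C i j - D i j := by
  intro i j k h
  linear_combination hC i j k h - hD i j k h

variable {T} in
theorem IsCocycle.const_mul {C : ℕ → ℕ → ℂ} (hC : T.IsCocycle C) (t : ℂ) :
    T.IsCocycle fun i j => t * C i j := by
  intro i j k h
  linear_combination t * hC i j k h

/-- The linear map `v_i ↦ a_i • v_i`. -/
def diag (a : ℕ → ℂ) : oneCochain ℂ T.Alg T.Alg := T.basis.constr ℂ fun i => a i • T.v i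

theorem diag_v (a : ℕ → ℂ) (i : ℕ) : T.diag a (T.v i) = a i • T.v i := by
  by_cases hi : i < T.n + 1
  · have := T.basis_apply ⟨i, hi⟩
    simp only at this
    rw [← this, diag, Module.Basis.constr_basis, this]
  · rw [T.v_of_lt (by omega), map_zero, smul_zero]

theorem d₁₂_diag (a : ℕ → ℂ) : d₁₂ ℂ T.Alg T.Alg (T.diag a) =
    T.homCochain (T.diagCoboundary a) (T.diagCoboundary_skew a) := by
  refine twoCochain_ext fun i _ j _ => ?_
  rw [homCochain_v, d₁₂_apply_apply]
  simp only [diag_v, lie_smul, lie_v, map_smul, smul_smul]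
  rw [add_comm j i, ← sub_smul, ← sub_smul, diagCoboundary, T.coeff_skew j i]
  congr 1
  ring

/-! ### Reduction to degree `0` -/

/-- The operator dividing the component of weight `k` by `w - k`, and killing it if `k = w`. -/
def divWeight (w : ℂ) : T.Alg →ₗ[ℂ] T.Alg := T.diag fun k => (w - k)⁻¹

theorem divWeight_v (w : ℂ) (k : ℕ) : T.divWeight w (T.v k) = (w - k)⁻¹ • T.v k := T.diag_v _ _

/-- Bracketing with `v_i` raises every weight by `i`, so the defect `w - k` is unchanged when `w` is
raised by `i` as well. This makes division by the defect commute with the coboundary. -/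
theorem divWeight_lie (i j : ℕ) (u : T.Alg) :
    T.divWeight ((i + j : ℕ) : ℂ) ⁅T.v i, u⁆ = ⁅T.v i, T.divWeight j u⁆ := by
  have : (T.divWeight ((i + j : ℕ) : ℂ)).comp (T.bilin T.coeff (T.v i)) =
      (T.bilin T.coeff (T.v i)).comp (T.divWeight j) := by
    refine T.basis.ext fun k => ?_
    simp only [LinearMap.comp_apply, basis_apply, bilin_v, divWeight_v, map_smul, smul_smul]
    rw [mul_comm]
    congr 3
    push_cast
    ring
  exact LinearMap.congr_fun this u

variable {T}

theorem lie_v_zero_left (hx : ∀ i, T.coeff i 0 = i) (i : ℕ) :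
    ⁅T.v 0, T.v i⁆ = -(i : ℂ) • T.v i := by
  rw [lie_v, T.coeff_skew, hx, zero_add]

/-- Dividing by the weight difference inverts its multiplication, off the kernel. -/
theorem divWeight_smul_add_lie (hx : ∀ i, T.coeff i 0 = i) (w : ℕ) (u : T.Alg) :
    T.divWeight w ((w : ℂ) • u + ⁅T.v 0, u⁆) = u - T.coord w u • T.v w := by
  have : (T.divWeight w).comp ((w : ℂ) • LinearMap.id + T.bilin T.coeff (T.v 0)) =
      LinearMap.id - (T.coord w).smulRight (T.v w) := by
    refine T.basis.ext fun k => ?_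
    have h0 := lie_v_zero_left hx (k : ℕ)
    change T.bilin T.coeff (T.v 0) (T.v k) = _ at h0
    simp only [LinearMap.comp_apply, basis_apply, LinearMap.add_apply, LinearMap.sub_apply,
      LinearMap.smul_apply, LinearMap.id_apply, LinearMap.smulRight_apply, h0, ← add_smul,
      map_smul, divWeight_v, smul_smul, T.coord_smul_v]
    split_ifs with h
    -- At `k = w` the weight defect is zero and the subtracted coordinate part is all of `v_k`, so
    -- both sides vanish.
    · simp [h]
    · have : (w : ℂ) - (k : ℕ) ≠ 0 := by
        rw [sub_ne_zero]
        exact_mod_cast Ne.symm h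
      rw [← sub_eq_add_neg, mul_inv_cancel₀ this]
      simp
  exact LinearMap.congr_fun this u

/-- Every cocycle is cohomologous to a homogeneous cocycle of degree `0`. -/
theorem exists_homCochain_of_mem_twoCocycle (hx : ∀ i, T.coeff i 0 = i)
    {φ : twoCochain ℂ T.Alg T.Alg} (hφ : φ ∈ twoCocycle ℂ T.Alg T.Alg) :
    ∃ (f : oneCochain ℂ T.Alg T.Alg) (C : ℕ → ℕ → ℂ) (hC : ∀ i j, C i j = -C j i),
      φ = d₁₂ ℂ T.Alg T.Alg f + T.homCochain C hC := by
  -- The contraction of `φ` with `x`; `f` is its quotient by the weight defects, with the defect `0`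
  -- part dropped because `0⁻¹ = 0`.
  let ψ : oneCochain ℂ T.Alg T.Alg := φ (T.v 0)
  let f : oneCochain ℂ T.Alg T.Alg :=
    T.basis.constr ℂ fun i => T.divWeight ((i : ℕ) : ℂ) (ψ (T.v i))
  have hf : ∀ i, f (T.v i) = T.divWeight (i : ℂ) (ψ (T.v i)) := by
    intro i
    by_cases hi : i < T.n + 1
    · have := T.basis_apply ⟨i, hi⟩
      simp only at this
      rw [← this, Module.Basis.constr_basis, this]
    · rw [T.v_of_lt (by omega), map_zero, map_zero, map_zero]
  have hd : ∀ i j, d₁₂ ℂ T.Alg T.Alg f (T.v i) (T.v j) =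
      T.divWeight ((i + j : ℕ) : ℂ) (d₁₂ ℂ T.Alg T.Alg ψ (T.v i) (T.v j)) := by
    intro i j
    rw [d₁₂_apply_apply, d₁₂_apply_apply, map_sub, map_sub, divWeight_lie, hf, hf, add_comm i j,
      divWeight_lie, lie_v, map_smul, map_smul, map_smul, hf, add_comm i j]
  -- Cartan's formula for the cocycle `φ`: the coboundary of its contraction with `x` is its Lie
  -- derivative along `x`, which scales the `v_k` component by `i + j - k`.
  have hψ : ∀ i j, d₁₂ ℂ T.Alg T.Alg ψ (T.v i) (T.v j) =
      ((i + j : ℕ) : ℂ) • φ (T.v i) (T.v j) + ⁅T.v 0, φ (T.v i) (T.v j)⁆ := by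
    intro i j
    rw [mem_twoCocycle_iff] at hφ
    have h := LinearMap.congr_fun (LinearMap.congr_fun
      (LinearMap.congr_fun hφ (T.v 0)) (T.v i)) (T.v j)
    rw [d₂₃_apply, lie_v_zero_left hx, lie_v_zero_left hx, map_smul, map_smul,
      LinearMap.smul_apply, LinearMap.smul_apply, ← twoCochain_skew φ (T.v i) (T.v j),
      ← twoCochain_skew φ (T.v 0)] at h
    simp only [LinearMap.zero_apply] at h
    rw [d₁₂_apply_apply]
    push_cast
    change ⁅T.v i, φ (T.v 0) (T.v j)⁆ - ⁅T.v j, φ (T.v 0) (T.v i)⁆ - φ (T.v 0) ⁅T.v i, T.v j⁆ = _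
    rw [← sub_eq_zero, ← neg_eq_zero, ← h]
    module
  refine ⟨f, fun i j => T.coord (i + j) (φ (T.v i) (T.v j)), fun i j => ?_, ?_⟩
  · change T.coord (i + j) (φ (T.v i) (T.v j)) = -T.coord (j + i) (φ (T.v j) (T.v i))
    rw [← twoCochain_skew φ (T.v j), map_neg, add_comm j i]
  · refine twoCochain_ext fun i _ j _ => ?_
    rw [add_apply_apply, homCochain_v, hd, hψ, divWeight_smul_add_lie hx, sub_add_cancel]

end GradedTable

/-! ### Transport along isomorphisms, and a dimension-one criterion -/

@[simp]
theorem twoCochain_sub_apply {K L M : Type*} [CommRing K] [LieRing L] [LieAlgebra K L]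
    [AddCommGroup M] [Module K M] (φ ψ : twoCochain K L M) (x y : L) :
    (φ - ψ) x y = φ x y - ψ x y := rfl

section Transport

variable {K L L' : Type*} [CommRing K] [LieRing L] [LieAlgebra K L] [LieRing L'] [LieAlgebra K L']

/-- Transport of adjoint `2`-cochains along an isomorphism of Lie algebras. -/
def LieEquiv.twoCochainPullback (e : L ≃ₗ⁅K⁆ L') (φ : twoCochain K L' L') : twoCochain K L L :=
  ⟨LinearMap.mk₂ K (fun x y => e.symm (φ (e x) (e y))) (by simp) (by simp) (by simp) (by simp),
    fun x => by simp⟩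

@[simp]
theorem LieEquiv.twoCochainPullback_apply (e : L ≃ₗ⁅K⁆ L') (φ : twoCochain K L' L') (x y : L) :
    e.twoCochainPullback φ x y = e.symm (φ (e x) (e y)) := rfl

theorem LieEquiv.twoCochainPullback_mem_twoCocycle (e : L ≃ₗ⁅K⁆ L') {φ : twoCochain K L' L'}
    (hφ : φ ∈ twoCocycle K L' L') : e.twoCochainPullback φ ∈ twoCocycle K L L := by
  rw [mem_twoCocycle_iff] at hφ ⊢
  ext x y z
  have h := LinearMap.congr_fun (LinearMap.congr_fun (LinearMap.congr_fun hφ (e x)) (e y)) (e z)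
  have h' := congrArg e.symm h
  simpa [LieEquiv.map_lie] using h'

theorem LieEquiv.twoCochainPullback_mem_range (e : L ≃ₗ⁅K⁆ L') {φ : twoCochain K L' L'}
    (hφ : φ ∈ LinearMap.range (d₁₂ K L' L')) :
    e.twoCochainPullback φ ∈ LinearMap.range (d₁₂ K L L) := by
  obtain ⟨f, rfl⟩ := hφ
  refine ⟨e.symm.toLinearMap ∘ₗ f ∘ₗ e.toLinearMap, ?_⟩
  apply Subtype.ext
  ext x y
  simp [LieEquiv.map_lie]

theorem LieEquiv.symm_twoCochainPullback (e : L ≃ₗ⁅K⁆ L') (φ : twoCochain K L' L') :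
    e.symm.twoCochainPullback (e.twoCochainPullback φ) = φ := by
  apply Subtype.ext
  ext x y
  simp

end Transport

theorem mem_range_lieD12_iff {K L M : Type*} [CommRing K] [LieRing L] [LieAlgebra K L]
    [AddCommGroup M] [Module K M] [LieRingModule L M] [LieModule K L M] (φ : LieZ2 K L M) :
    φ ∈ LinearMap.range (lieD12 K L M) ↔
      ((show twoCocycle K L M from φ) : twoCochain K L M) ∈ LinearMap.range (d₁₂ K L M) := by
  constructor
  · rintro ⟨f, rfl⟩
    exact ⟨f, rfl⟩
  · rintro ⟨f, hf⟩
    exact ⟨f, Subtype.ext hf⟩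

theorem finrank_LieH2_eq_one {K L M : Type*} [Field K] [LieRing L] [LieAlgebra K L]
    [AddCommGroup M] [Module K M] [LieRingModule L M] [LieModule K L M] {p : twoCochain K L M}
    (hp : p ∈ twoCocycle K L M) (hp' : p ∉ LinearMap.range (d₁₂ K L M))
    (h : ∀ φ ∈ twoCocycle K L M, ∃ t : K, φ - t • p ∈ LinearMap.range (d₁₂ K L M)) :
    Module.finrank K (LieH2 K L M) = 1 := by
  let P : LieZ2 K L M := (⟨p, hp⟩ : twoCocycle K L M)
  refine finrank_eq_one ((LinearMap.range (lieD12 K L M)).mkQ P) ?_ fun w => ?_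
  · rw [Submodule.mkQ_apply, Ne, Submodule.Quotient.mk_eq_zero, mem_range_lieD12_iff]
    exact hp'
  · obtain ⟨φ, rfl⟩ := Submodule.mkQ_surjective _ w
    obtain ⟨t, ht⟩ := h _ (show twoCocycle K L M from φ).2
    refine ⟨t, ?_⟩
    rw [← map_smul, eq_comm, ← sub_eq_zero, ← map_sub, Submodule.mkQ_apply,
      Submodule.Quotient.mk_eq_zero, mem_range_lieD12_iff]
    exact ht

/-- Conjugation by `e` and by its inverse preserves cocycles and coboundaries, so the spanning class
is moved at the level of cochains and no isomorphism of cohomology spaces has to be built. -/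
theorem LieEquiv.finrank_LieH2_eq_one {K L L' : Type*} [Field K] [LieRing L] [LieAlgebra K L]
    [LieRing L'] [LieAlgebra K L'] (e : L ≃ₗ⁅K⁆ L') {p : twoCochain K L' L'}
    (hp : p ∈ twoCocycle K L' L') (hp' : p ∉ LinearMap.range (d₁₂ K L' L'))
    (h : ∀ φ ∈ twoCocycle K L' L', ∃ t : K, φ - t • p ∈ LinearMap.range (d₁₂ K L' L')) :
    Module.finrank K (LieH2 K L L) = 1 := by
  refine _root_.finrank_LieH2_eq_one (e.twoCochainPullback_mem_twoCocycle hp) (fun hr => hp' ?_)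
    fun φ hφ => ?_
  · rw [← e.symm_twoCochainPullback p]
    exact e.symm.twoCochainPullback_mem_range hr
  · obtain ⟨t, ht⟩ := h _ (e.symm.twoCochainPullback_mem_twoCocycle hφ)
    refine ⟨t, ?_⟩
    convert e.twoCochainPullback_mem_range ht
    apply Subtype.ext
    ext x y
    rw [twoCochain_val_apply, twoCochain_val_apply, LieEquiv.twoCochainPullback_apply]
    simp [twoCochain_sub_apply]

/-! ### Detecting the class by one entry -/

namespace GradedTable

variable {T : GradedTable}

theorem cochain_mem_twoCocycle {p : ℕ → ℕ → ℚ}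
    (hp : T.IsCocycle fun i j => ((p i j - p j i : ℚ) : ℂ)) :
    T.cochain p ∈ twoCocycle ℂ T.Alg T.Alg :=
  (T.homCochain_mem_twoCocycle_iff _ fun i j => by simp).2 hp

/-- The `v_{i+j}` coordinate of `[v_i, u]` sees only the `v_j` coordinate of `u`, with factor
`T.coeff i j`. When that coefficient is zero, every coboundary, of whatever degree, has zero
`v_{i+j}` coordinate at `(v_i, v_j)`. -/
theorem cochain_notMem_range {p : ℕ → ℕ → ℚ} (i j : ℕ) (hij : i + j ≤ T.n)
    (hc : T.coeff i j = 0) (hp : p i j - p j i ≠ 0) :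
    T.cochain p ∉ LinearMap.range (d₁₂ ℂ T.Alg T.Alg) := by
  rintro ⟨f, hf⟩
  apply hp
  have h : d₁₂ ℂ T.Alg T.Alg f (T.v i) (T.v j) = T.cochain p (T.v i) (T.v j) := by rw [hf]
  rw [cochain_v, d₁₂_apply_apply, lie_v, hc, zero_smul, map_zero, sub_zero] at h
  have h' := congrArg (T.coord (i + j)) h
  rw [map_sub, T.coord_lie_v i j hij, add_comm i j, T.coord_lie_v j i (by omega), map_smul,
    T.coord_v _ _ (by omega), T.coeff_skew j, hc] at h'
  exact_mod_cast (by simpa using h'.symm : ((p i j : ℂ) - p j i) = 0)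

/-- The scalar `t` is the ratio of the `(i₀, j₀)` entries of the degree `0` part of `φ` and of `p`;
after subtraction `h` applies. -/
theorem exists_sub_smul_cochain_mem_range (hx : ∀ i, T.coeff i 0 = i) {p : ℕ → ℕ → ℚ}
    (hp : T.IsCocycle fun i j => ((p i j - p j i : ℚ) : ℂ)) (i₀ j₀ : ℕ)
    (hp₀ : p i₀ j₀ - p j₀ i₀ ≠ 0)
    (h : ∀ C : ℕ → ℕ → ℂ, (∀ i j, C i j = -C j i) → T.IsCocycle C → C i₀ j₀ = 0 →
      ∃ a, ∀ i j, i + j ≤ T.n → C i j = T.diagCoboundary a i j)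
    {φ : twoCochain ℂ T.Alg T.Alg} (hφ : φ ∈ twoCocycle ℂ T.Alg T.Alg) :
    ∃ t : ℂ, φ - t • T.cochain p ∈ LinearMap.range (d₁₂ ℂ T.Alg T.Alg) := by
  obtain ⟨f, C, hC, rfl⟩ := exists_homCochain_of_mem_twoCocycle hx hφ
  have hC' : T.IsCocycle C := by
    rw [← T.homCochain_mem_twoCocycle_iff C hC]
    rw [mem_twoCocycle_iff] at hφ ⊢
    rwa [map_add, show d₂₃ ℂ T.Alg T.Alg (d₁₂ ℂ T.Alg T.Alg f) = 0 from
      LinearMap.congr_fun (d₂₃_comp_d₁₂ ℂ T.Alg T.Alg) f, zero_add] at hφ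
  obtain ⟨P, hPp⟩ : ∃ P : ℕ → ℕ → ℂ, ∀ i j, P i j = ((p i j - p j i : ℚ) : ℂ) :=
    ⟨_, fun _ _ => rfl⟩
  simp only [← hPp] at hp
  have hP : ∀ i j, P i j = -P j i := fun i j => by simp [hPp]
  have hP₀ : P i₀ j₀ ≠ 0 := by rw [hPp]; exact Rat.cast_ne_zero.2 hp₀
  obtain ⟨t, ht⟩ : ∃ t, C i₀ j₀ - t * P i₀ j₀ = 0 :=
    ⟨C i₀ j₀ / P i₀ j₀, by rw [div_mul_cancel₀ _ hP₀, sub_self]⟩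
  obtain ⟨a, ha⟩ := h (fun i j => C i j - t * P i j)
    (fun i j => by rw [hC i j, hP i j]; ring) (hC'.sub (IsCocycle.const_mul hp t)) ht
  refine ⟨t, f + T.diag a, ?_⟩
  rw [map_add, d₁₂_diag]
  refine twoCochain_ext fun i _ j _ => ?_
  rw [twoCochain_sub_apply, add_apply_apply, add_apply_apply, smul_apply_apply, add_sub_assoc,
    homCochain_v, homCochain_v, cochain_v, ← hPp, smul_smul, ← sub_smul]
  by_cases hij : i + j ≤ T.n
  · rw [← ha i j hij]
  · rw [T.v_of_lt (k := i + j) (by omega), smul_zero, smul_zero]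

/-- A criterion for the adjoint cohomology of the algebra of a multiplication table to be spanned
by the class of a given homogeneous cochain. -/
theorem finrank_LieH2_eq_one_and (hx : ∀ i, T.coeff i 0 = i) {p : ℕ → ℕ → ℚ}
    (hp : T.IsCocycle fun i j => ((p i j - p j i : ℚ) : ℂ)) (i₀ j₀ : ℕ) (hle : i₀ + j₀ ≤ T.n)
    (hc : T.coeff i₀ j₀ = 0) (hp₀ : p i₀ j₀ - p j₀ i₀ ≠ 0)
    (h : ∀ C : ℕ → ℕ → ℂ, (∀ i j, C i j = -C j i) → T.IsCocycle C → C i₀ j₀ = 0 →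
      ∃ a, ∀ i j, i + j ≤ T.n → C i j = T.diagCoboundary a i j) :
    (∀ (R : Type*) [LieRing R] [LieAlgebra ℂ R], Nonempty (R ≃ₗ⁅ℂ⁆ T.Alg) →
      Module.finrank ℂ (LieH2 ℂ R R) = 1) ∧
    T.cochain p ∈ twoCocycle ℂ T.Alg T.Alg ∧
    T.cochain p ∉ LinearMap.range (d₁₂ ℂ T.Alg T.Alg) := by
  have h1 := cochain_mem_twoCocycle hp
  have h2 := cochain_notMem_range i₀ j₀ hle hc hp₀
  refine ⟨fun R _ _ ⟨e⟩ => ?_, h1, h2⟩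
  exact e.finrank_LieH2_eq_one h1 h2 fun φ hφ =>
    exists_sub_smul_cochain_mem_range hx hp i₀ j₀ hp₀ h hφ

theorem eq_zero_of_forall_lt {C : ℕ → ℕ → ℂ} (hC : ∀ i j, C i j = -C j i)
    (h : ∀ i j, i < j → i + j ≤ T.n → C i j = 0) (i j : ℕ) (hij : i + j ≤ T.n) : C i j = 0 := by
  rcases lt_trichotomy i j with hlt | rfl | hlt
  · exact h i j hlt hij
  · exact self_eq_neg.1 (hC i i)
  · rw [hC, h j i hlt (by omega), neg_zero]

/-- A criterion for a cocycle to be the coboundary of a given diagonal map. -/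
theorem eq_diagCoboundary {C : ℕ → ℕ → ℂ} (hC : ∀ i j, C i j = -C j i) (hC' : T.IsCocycle C)
    (a : ℕ → ℂ) (h : ∀ D : ℕ → ℕ → ℂ, (∀ i j, D i j = -D j i) → T.IsCocycle D →
      (∀ i j, D i j = C i j - T.diagCoboundary a i j) → ∀ i j, i < j → i + j ≤ T.n → D i j = 0)
    (i j : ℕ) (hij : i + j ≤ T.n) : C i j = T.diagCoboundary a i j := by
  have hD : ∀ i j, C i j - T.diagCoboundary a i j = -(C j i - T.diagCoboundary a j i) :=
    fun i j => by rw [hC i j, T.diagCoboundary_skew a i j]; ring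
  exact sub_eq_zero.1 (eq_zero_of_forall_lt hD
    (h _ hD (hC'.sub (T.isCocycle_diagCoboundary a)) fun _ _ => rfl) i j hij)

end GradedTable

/-! ### Verification of the given cocycles -/

theorem Rg7_coeff_zero (i : ℕ) : Rg7.coeff i 0 = i := by
  rcases i with _ | i <;> simp [GradedTable.coeff, Rg7]

theorem Rg3_coeff_zero (n i : ℕ) : (Rg3 n).coeff i 0 = i := by
  rcases i with _ | i <;> simp [GradedTable.coeff, Rg3]

/-- The cocycle expression is alternating in `(i, j, k)`, so strictly increasing triples suffice. -/
theorem GradedTable.isCocycle_of_lt {T : GradedTable} {C : ℕ → ℕ → ℂ}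
    (hC : ∀ i j, C i j = -C j i) (h : ∀ i j k, i < j → j < k → i + j + k ≤ T.n →
      T.coeff i (j + k) * C j k + T.coeff j (k + i) * C k i + T.coeff k (i + j) * C i j +
        (C i (j + k) * T.coeff j k + C j (k + i) * T.coeff k i + C k (i + j) * T.coeff i j) = 0) :
    T.IsCocycle C := by
  have h₁ : ∀ i j k, i < j → i + j + k ≤ T.n →
      T.coeff i (j + k) * C j k + T.coeff j (k + i) * C k i + T.coeff k (i + j) * C i j +
        (C i (j + k) * T.coeff j k + C j (k + i) * T.coeff k i + C k (i + j) * T.coeff i j) =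
      0 := by
    intro i j k hij hle
    have hs := T.coeff_skew
    rcases lt_trichotomy j k with hjk | rfl | hjk
    · exact h i j k hij hjk hle
    · rw [self_eq_neg.1 (hC j j), self_eq_neg.1 (hs j j), hs j i, hC j i, add_comm i j]
      ring
    rcases lt_trichotomy i k with hik | rfl | hik
    · rw [hC j k, hC k i, hC i j, hs j k, hs k i, hs i j, add_comm j k, add_comm k i, add_comm i j]
      linear_combination -h i k j hik hjk (by omega)
    · rw [self_eq_neg.1 (hC i i), self_eq_neg.1 (hs i i), hs j i, hC j i, add_comm i j]
      ring
    · linear_combination h k i j hik hij (by omega)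
  intro i j k hle
  have hs := T.coeff_skew
  rcases lt_trichotomy i j with hij | rfl | hij
  · exact h₁ i j k hij hle
  · rw [self_eq_neg.1 (hC i i), self_eq_neg.1 (hs i i), hs i k, hC i k, add_comm i k]
    ring
  · rw [hC j k, hC k i, hC i j, hs j k, hs k i, hs i j, add_comm j k, add_comm k i, add_comm i j]
    linear_combination -h₁ j i k hij (by omega)

/-- The cocycle identity for rational coefficients. -/
theorem GradedTable.isCocycle_of_rat {T : GradedTable} {p : ℕ → ℕ → ℚ}
    (h : ∀ k < T.n + 1, ∀ j < k, ∀ i < j, i + j + k ≤ T.n →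
      ((T.half i (j + k) - T.half (j + k) i : ℤ) : ℚ) * (p j k - p k j) +
      ((T.half j (k + i) - T.half (k + i) j : ℤ) : ℚ) * (p k i - p i k) +
      ((T.half k (i + j) - T.half (i + j) k : ℤ) : ℚ) * (p i j - p j i) +
      ((p i (j + k) - p (j + k) i) * ((T.half j k - T.half k j : ℤ) : ℚ) +
      (p j (k + i) - p (k + i) j) * ((T.half k i - T.half i k : ℤ) : ℚ) +
      (p k (i + j) - p (i + j) k) * ((T.half i j - T.half j i : ℤ) : ℚ)) = 0) :
    T.IsCocycle fun i j => ((p i j - p j i : ℚ) : ℂ) := by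
  refine isCocycle_of_lt (fun i j => by simp) fun i j k hij hjk hijk => ?_
  have := congrArg (Rat.cast : ℚ → ℂ) (h k (by omega) j hjk i hij hijk)
  simp only [coeff]
  push_cast at this ⊢
  exact this

theorem rg7Values_isCocycle : Rg7.IsCocycle fun i j => ((rg7Values i j - rg7Values j i : ℚ) : ℂ) :=
  GradedTable.isCocycle_of_rat (by decide +kernel)

theorem rg9Values_isCocycle : Rg9.IsCocycle fun i j => ((rg9Values i j - rg9Values j i : ℚ) : ℂ) :=
  GradedTable.isCocycle_of_rat (by decide +kernel)

theorem rg11Values_isCocycle :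
    Rg11.IsCocycle fun i j => ((rg11Values i j - rg11Values j i : ℚ) : ℂ) :=
  GradedTable.isCocycle_of_rat (by decide +kernel)

set_option maxHeartbeats 4000000 in
-- From index `6` on, the structure constants and the cocycle values are given by uniform formulas,
-- constant or affine in the index. Treating `0, …, 5` separately leaves finitely many identities,
-- valid for all `n` at once.
theorem rg3Values_isCocycle (n : ℕ) :
    (Rg3 n).IsCocycle fun i j => ((rg3Values i j - rg3Values j i : ℚ) : ℂ) := by
  apply GradedTable.isCocycle_of_rat
  intro k _ j hjk i hij _
  have e : ∀ i : ℕ, i = 0 ∨ i = 1 ∨ i = 2 ∨ i = 3 ∨ i = 4 ∨ i = 5 ∨ ∃ m, i = m + 6 := fun i => by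
    rcases i with _ | _ | _ | _ | _ | _ | i <;> simp
  obtain rfl | rfl | rfl | rfl | rfl | rfl | ⟨i, rfl⟩ := e i <;>
  obtain rfl | rfl | rfl | rfl | rfl | rfl | ⟨j, rfl⟩ := e j <;> (try omega) <;>
  obtain rfl | rfl | rfl | rfl | rfl | rfl | ⟨k, rfl⟩ := e k <;> (try omega) <;>
  simp [Rg3, rg3Values] <;> (try split_ifs) <;> (try omega) <;> (try ring_nf)

/-- The row of index `0` of a homogeneous cocycle is a diagonal derivation. -/
theorem GradedTable.IsCocycle.derivation {T : GradedTable} {C : ℕ → ℕ → ℂ} (hC : T.IsCocycle C)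
    (hx : ∀ i, T.coeff i 0 = i) (hs : ∀ i j, C i j = -C j i) (i j : ℕ) (h : i + j ≤ T.n) :
    T.coeff i j * (C 0 i + C 0 j - C 0 (i + j)) = 0 := by
  have := hC 0 i j (by omega)
  rw [T.coeff_skew 0 (i + j), hx, add_zero, hx, zero_add, T.coeff_skew 0 i, hx, hs j 0,
    T.coeff_skew j i, hs j i] at this
  push_cast at this
  linear_combination -this

/-! ### Degree `0` cocycles of `R(g³_{(n,1)}, 1)` -/

open GradedTable in
-- Row `0` is a diagonal derivation vanishing on `v_1`, hence zero. Once rows `1` and `2` vanish,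
-- the identities involving `v_1` and `v_2` become two shift recurrences on the remaining entries,
-- and these are incompatible unless the entries are zero.
theorem Rg3_cocycle_eq_zero {n : ℕ} (hn : 7 ≤ n) {C : ℕ → ℕ → ℂ} (hs : ∀ i j, C i j = -C j i)
    (hC : (Rg3 n).IsCocycle C) (h01 : C 0 1 = 0) (h12 : C 1 2 = 0)
    (h1 : ∀ j, 3 ≤ j → 1 + j ≤ n → C 1 j = 0) (h23 : C 2 3 = 0) (h34 : C 3 4 = 0)
    {i j : ℕ} (hij : i < j) (hle : i + j ≤ n) : C i j = 0 := by
  have c1 : ∀ j, 3 ≤ j → (Rg3 n).coeff 1 j = 1 := fun j hj => by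
    simp [coeff, Rg3]; grind
  have c1' : ∀ j, 3 ≤ j → (Rg3 n).coeff j 1 = -1 := fun j hj => by rw [coeff_skew, c1 j hj]
  have c12 : (Rg3 n).coeff 1 2 = 0 := by simp [coeff, Rg3]
  have c2' : ∀ j, 3 ≤ j → (Rg3 n).coeff j 2 = 1 := fun j hj => by
    simp [coeff, Rg3]; grind
  have c2 : ∀ j, 3 ≤ j → (Rg3 n).coeff 2 j = -1 := fun j hj => by rw [coeff_skew, c2' j hj]
  have c3 : ∀ j, 4 ≤ j → (Rg3 n).coeff 3 j = 1 := fun j hj => by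
    simp [coeff, Rg3]; grind
  have d := hC.derivation (Rg3_coeff_zero n) hs
  have d1 : ∀ j, 3 ≤ j → 1 + j ≤ n → C 0 (j + 1) = C 0 j := by
    intro j h3 hj
    have := d 1 j hj
    rw [c1 j h3, h01, add_comm 1 j] at this
    linear_combination -this
  have d1' : ∀ j, 3 ≤ j → j ≤ n → C 0 j = C 0 3 := by
    intro j h3
    induction j, h3 using Nat.le_induction with
    | base => simp
    | succ j h3 ih => exact fun hj => (d1 j h3 (by omega)).trans (ih (by omega))
  have d2 : C 0 2 = 0 := by
    have := d 2 3 (by change 2 + 3 ≤ n; omega)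
    rw [c2 3 le_rfl, d1' 5 (by omega) (by omega)] at this
    linear_combination -this
  -- Uses `[v_3, v_4] = v_7`, which requires `v_7 ≠ 0`, hence `7 ≤ n`.
  have d3 : C 0 3 = 0 := by
    have := d 3 4 (by change 3 + 4 ≤ n; omega)
    rw [c3 4 le_rfl, d1' 4 (by omega) (by omega), d1' 7 (by omega) (by omega)] at this
    linear_combination this
  have r2 : ∀ j, 3 ≤ j → 2 + j ≤ n → C 2 j = 0 := by
    intro j h3
    induction j, h3 using Nat.le_induction with
    | base => exact fun _ => h23
    | succ j h3 ih =>
      intro hj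
      have := hC 1 2 j (by change 1 + 2 + j ≤ n; omega)
      rw [c1 _ (by omega), c1' j h3, c12, h12, ih (by omega), h1 (2 + j) (by omega) (by omega),
        hs j 1, h1 j h3 (by omega)] at this
      linear_combination -this
  have e1 : ∀ i j, 3 ≤ i → 3 ≤ j → i + j + 1 ≤ n → C i j = C (i + 1) j + C i (j + 1) := by
    intro i j hi hj h
    have := hC 1 i j (by change 1 + i + j ≤ n; omega)
    rw [c1 _ (by omega), c1' j hj, c1 i hi, hs j 1, h1 j hj (by omega), h1 i hi (by omega),
      h1 (i + j) (by omega) (by omega), hs j, add_comm 1 i] at this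
    linear_combination this
  have e2 : ∀ i j, 3 ≤ i → 3 ≤ j → i + j + 2 ≤ n → C i j = C (i + 2) j + C i (j + 2) := by
    intro i j hi hj h
    have := hC 2 i j (by change 2 + i + j ≤ n; omega)
    rw [c2 _ (by omega), c2' j hj, c2 i hi, hs j 2, r2 j hj (by omega), r2 i hi (by omega),
      r2 (i + j) (by omega) (by omega), hs j, add_comm 2 i] at this
    linear_combination -this
  -- With `S`, `T` the shifts in the two indices, `e1` says `1 = S + T` and `e2` says `1 = S² + T²`.
  -- Squaring the first gives `2ST = 0`.
  have e4 : ∀ i j, 4 ≤ i → 4 ≤ j → i + j ≤ n → C i j = 0 := by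
    intro i j hi hj h
    obtain ⟨i, rfl⟩ : ∃ k, i = k + 1 := ⟨i - 1, by omega⟩
    obtain ⟨j, rfl⟩ : ∃ k, j = k + 1 := ⟨j - 1, by omega⟩
    linear_combination (e2 i j (by omega) (by omega) (by omega) -
      e1 i j (by omega) (by omega) (by omega) - e1 (i + 1) j (by omega) (by omega) (by omega) -
      e1 i (j + 1) (by omega) (by omega) (by omega)) / 2
  have r3 : ∀ j, 4 ≤ j → 3 + j ≤ n → C 3 j = 0 := by
    intro j h4
    induction j, h4 using Nat.le_induction with
    | base => exact fun _ => h34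
    | succ j h4 ih =>
      intro hj
      linear_combination ih (by omega) - e1 3 j le_rfl (by omega) (by omega) -
        e4 4 j le_rfl h4 (by omega)
  rcases i with _ | _ | _ | _ | i
  · rcases j with _ | _ | _ | j
    · omega
    · exact h01
    · exact d2
    · rw [d1' _ (by omega) (by omega), d3]
  · rcases j with _ | _ | _ | j
    · omega
    · omega
    · exact h12
    · exact h1 _ (by omega) (by omega)
  · exact r2 j (by omega) hle
  · exact r3 j (by omega) hle
  · exact e4 _ j (by omega) (by omega) hle

open GradedTable in
-- The weights `a_i = i`, those of a multiple of `ad x`, have zero coboundary, so `a 1 = 0` costs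
-- nothing.
theorem Rg3_exists_eq_diagCoboundary {n : ℕ} (hn : 7 ≤ n) (C : ℕ → ℕ → ℂ)
    (hs : ∀ i j, C i j = -C j i) (hC : (Rg3 n).IsCocycle C) (h12 : C 1 2 = 0) :
    ∃ a, ∀ i j, i + j ≤ n → C i j = (Rg3 n).diagCoboundary a i j := by
  -- `a 0` clears entry `(0, 1)`, `a 2` clears `(2, 3)`, and the sums make consecutive differences
  -- clear `(1, j)` for `j ≥ 3`. The constant common to all `a (m + 3)` is fixed by `(3, 4)`,
  -- through `a 3 + a 4 - a 7`.
  let a : ℕ → ℂ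
    | 0 => -C 0 1
    | 1 => 0
    | 2 => -C 2 3 - C 1 3 - C 1 4
    | m + 3 => C 3 4 - C 1 4 - C 1 5 - C 1 6 - ∑ t ∈ Finset.range m, C 1 (t + 3)
  refine ⟨a, eq_diagCoboundary hs hC a fun D hDs hD hDC i j hij hle =>
    Rg3_cocycle_eq_zero hn hDs hD ?_ ?_ (fun j h3 _ => ?_) ?_ ?_ hij hle⟩
  · simp [hDC, diagCoboundary, coeff, Rg3, a]
  · simp [hDC, diagCoboundary, coeff, Rg3, h12]
  · obtain ⟨m, rfl⟩ : ∃ m, j = m + 3 := ⟨j - 3, by omega⟩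
    have hc : (Rg3 n).coeff 1 (m + 3) = 1 := by simp [coeff, Rg3]
    rw [hDC, diagCoboundary, hc, show 1 + (m + 3) = m + 1 + 3 by omega]
    simp only [a, Finset.sum_range_succ]
    ring
  · simp [hDC, diagCoboundary, coeff, Rg3, a, Finset.sum_range_succ]
    ring
  · simp [hDC, diagCoboundary, coeff, Rg3, a, Finset.sum_range_succ]
    ring

/-! ### Degree `0` cocycles of the algebras with `n = 7, 9, 11` -/

/-- Normalisation of cocycles for tables in which `v_1` and `v_2` generate the nilradical. -/
theorem GradedTable.exists_eq_diagCoboundary {T : GradedTable} (hn : 7 ≤ T.n)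
    (hx : ∀ i, T.coeff i 0 = i) (c1 : ∀ j, 2 ≤ j → j + 1 < T.n → T.coeff 1 j = 1)
    (c1n : T.coeff 1 (T.n - 1) = 0) (c23 : T.coeff 2 3 = 1) (c2n : T.coeff 2 (T.n - 2) = 1)
    (hzero : ∀ D : ℕ → ℕ → ℂ, (∀ i j, D i j = -D j i) → T.IsCocycle D → D 0 1 = 0 →
      (∀ j, 2 ≤ j → 1 + j ≤ T.n → D 1 j = 0) → D 2 3 = 0 → D 2 (T.n - 2) = 0 →
      ∀ i j, i < j → i + j ≤ T.n → D i j = 0)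
    (C : ℕ → ℕ → ℂ) (hs : ∀ i j, C i j = -C j i) (hC : T.IsCocycle C)
    (h : C 1 (T.n - 1) = 0) : ∃ a, ∀ i j, i + j ≤ T.n → C i j = T.diagCoboundary a i j := by
  -- The value of `a 2`, solved from entry `(2, 3)`, where `a 3 - a 5 = C 1 3 + C 1 4`.
  let y := C 2 3 - C 1 3 - C 1 4
  let b : ℕ → ℂ := fun j => y - ∑ t ∈ Finset.range (j - 2), C 1 (t + 2)
  -- Index `T.n` is exceptional: `[v_1, v_{n-1}] = 0`, so `a T.n` is not tied to the recursion along
  -- `v_1` and is used to clear entry `(2, n - 2)`.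
  let a : ℕ → ℂ := fun j => if j = 0 then -C 0 1 else if j = 1 then 0
    else if j = T.n then y + b (T.n - 2) - C 2 (T.n - 2) else b j
  have a0 : a 0 = -C 0 1 := rfl
  have a1 : a 1 = 0 := rfl
  have an : a T.n = y + b (T.n - 2) - C 2 (T.n - 2) := by
    simp only [a]
    rw [if_neg (by omega), if_neg (by omega), if_pos trivial]
  have ab : ∀ j, 2 ≤ j → j < T.n → a j = b j := fun j _ _ => by
    simp only [a]
    rw [if_neg (by omega), if_neg (by omega), if_neg (by omega)]
  have b2 : b 2 = y := by simp [b]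
  have hb : ∀ j, 2 ≤ j → b (j + 1) = b j - C 1 j := by
    intro j hj
    obtain ⟨m, rfl⟩ : ∃ m, j = m + 2 := ⟨j - 2, by omega⟩
    simp only [b, show m + 2 + 1 - 2 = m + 1 by omega, Nat.add_sub_cancel, Finset.sum_range_succ]
    ring
  refine ⟨a, eq_diagCoboundary hs hC a fun D hDs hD hDC => hzero D hDs hD ?_ ?_ ?_ ?_⟩
  · rw [hDC, diagCoboundary, T.coeff_skew, hx, a0, zero_add]
    push_cast
    ring
  · intro j h2 hj
    rw [hDC, diagCoboundary, add_comm 1 j]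
    rcases (show j + 1 = T.n ∨ j + 1 < T.n by omega) with hj' | hj'
    · obtain rfl : j = T.n - 1 := by omega
      rw [h, c1n]
      ring
    · rw [c1 j h2 hj', a1, ab j h2 (by omega), ab _ (by omega) hj', hb j h2]
      ring
  · rw [hDC, diagCoboundary, c23, ab 2 le_rfl (by omega), ab 3 (by omega) (by omega),
      ab 5 (by omega) (by omega), hb 4 (by omega), hb 3 (by omega), b2]
    simp only [y]
    ring
  · rw [hDC, diagCoboundary, c2n, ab 2 le_rfl (by omega), ab _ (by omega) (by omega),
      show 2 + (T.n - 2) = T.n by omega, an, b2]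
    ring

theorem Rg9_coeff_zero (i : ℕ) : Rg9.coeff i 0 = i := by
  rcases i with _ | i <;> simp [GradedTable.coeff, Rg9]

theorem Rg11_coeff_zero (i : ℕ) : Rg11.coeff i 0 = i := by
  rcases i with _ | i <;> simp [GradedTable.coeff, Rg11]

open GradedTable in
-- Outside row `0` only `C 2 4` and `C 3 4` remain, and the triples `(1, 2, 3)` and `(1, 2, 4)` kill
-- them.
theorem Rg7_cocycle_eq_zero {C : ℕ → ℕ → ℂ} (hs : ∀ i j, C i j = -C j i)
    (hC : Rg7.IsCocycle C) (h01 : C 0 1 = 0) (h1 : ∀ j, 2 ≤ j → 1 + j ≤ 7 → C 1 j = 0)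
    (h23 : C 2 3 = 0) (h25 : C 2 5 = 0)
    {i j : ℕ} (hij : i < j) (hle : i + j ≤ 7) : C i j = 0 := by
  have d := hC.derivation Rg7_coeff_zero hs
  have hs' : ∀ i j, j < i → C i j = -C j i := fun i j _ => hs i j
  have hd : ∀ i, C i i = 0 := fun i => self_eq_neg.1 (hs i i)
  have h12 := h1 2 (by decide) (by decide)
  have h13 := h1 3 (by decide) (by decide)
  have h14 := h1 4 (by decide) (by decide)
  have h15 := h1 5 (by decide) (by decide)
  have h16 := h1 6 (by decide) (by decide)
  have d12 := d 1 2 (by decide)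
  have d13 := d 1 3 (by decide)
  have d14 := d 1 4 (by decide)
  have d15 := d 1 5 (by decide)
  have d23 := d 2 3 (by decide)
  have d25 := d 2 5 (by decide)
  have e123 := hC 1 2 3 (by decide)
  have e124 := hC 1 2 4 (by decide)
  simp [coeff, Rg7, h01, h23, h25, h12, h13, h14, h15, h16, hs', hd]
    at d12 d13 d14 d15 d23 d25 e123 e124
  clear hs hs' d hC h1 hd
  -- Coarse bounds suffice for the enumeration; pairs outside the range are discarded by `omega`.
  have hi : i < 6 := by omega
  have hj : j < 12 := by omega
  interval_cases j <;> interval_cases i <;> first | assumption | omega | grind only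

open GradedTable in
-- Outside row `0`, seven unknown entries remain. The six selected identities involving `v_1` are
-- supplemented by `(2, 3, 4)`.
theorem Rg9_cocycle_eq_zero {C : ℕ → ℕ → ℂ} (hs : ∀ i j, C i j = -C j i)
    (hC : Rg9.IsCocycle C) (h01 : C 0 1 = 0) (h1 : ∀ j, 2 ≤ j → 1 + j ≤ 9 → C 1 j = 0)
    (h23 : C 2 3 = 0) (h27 : C 2 7 = 0)
    {i j : ℕ} (hij : i < j) (hle : i + j ≤ 9) : C i j = 0 := by
  have d := hC.derivation Rg9_coeff_zero hs
  have hs' : ∀ i j, j < i → C i j = -C j i := fun i j _ => hs i j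
  have hd : ∀ i, C i i = 0 := fun i => self_eq_neg.1 (hs i i)
  have h12 := h1 2 (by decide) (by decide)
  have h13 := h1 3 (by decide) (by decide)
  have h14 := h1 4 (by decide) (by decide)
  have h15 := h1 5 (by decide) (by decide)
  have h16 := h1 6 (by decide) (by decide)
  have h17 := h1 7 (by decide) (by decide)
  have h18 := h1 8 (by decide) (by decide)
  have d12 := d 1 2 (by decide)
  have d13 := d 1 3 (by decide)
  have d14 := d 1 4 (by decide)
  have d15 := d 1 5 (by decide)
  have d16 := d 1 6 (by decide)
  have d17 := d 1 7 (by decide)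
  have d23 := d 2 3 (by decide)
  have d27 := d 2 7 (by decide)
  have e123 := hC 1 2 3 (by decide)
  have e124 := hC 1 2 4 (by decide)
  have e125 := hC 1 2 5 (by decide)
  have e126 := hC 1 2 6 (by decide)
  have e134 := hC 1 3 4 (by decide)
  have e135 := hC 1 3 5 (by decide)
  have e234 := hC 2 3 4 (by decide)
  simp [coeff, Rg9, h01, h23, h27, h12, h13, h14, h15, h16, h17, h18, hs', hd]
    at d12 d13 d14 d15 d16 d17 d23 d27 e123 e124 e125 e126 e134 e135 e234
  clear hs hs' d hC h1 hd
  have hi : i < 6 := by omega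
  have hj : j < 12 := by omega
  interval_cases j <;> interval_cases i <;> first | assumption | omega | grind only

open GradedTable in
-- Fourteen entries remain outside row `0`; twelve identities involving `v_1` and four starting at
-- `v_2` determine them.
theorem Rg11_cocycle_eq_zero {C : ℕ → ℕ → ℂ} (hs : ∀ i j, C i j = -C j i)
    (hC : Rg11.IsCocycle C) (h01 : C 0 1 = 0) (h1 : ∀ j, 2 ≤ j → 1 + j ≤ 11 → C 1 j = 0)
    (h23 : C 2 3 = 0) (h29 : C 2 9 = 0)
    {i j : ℕ} (hij : i < j) (hle : i + j ≤ 11) : C i j = 0 := by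
  have d := hC.derivation Rg11_coeff_zero hs
  have hs' : ∀ i j, j < i → C i j = -C j i := fun i j _ => hs i j
  have hd : ∀ i, C i i = 0 := fun i => self_eq_neg.1 (hs i i)
  have h12 := h1 2 (by decide) (by decide)
  have h13 := h1 3 (by decide) (by decide)
  have h14 := h1 4 (by decide) (by decide)
  have h15 := h1 5 (by decide) (by decide)
  have h16 := h1 6 (by decide) (by decide)
  have h17 := h1 7 (by decide) (by decide)
  have h18 := h1 8 (by decide) (by decide)
  have h19 := h1 9 (by decide) (by decide)
  have h110 := h1 10 (by decide) (by decide)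
  have d12 := d 1 2 (by decide)
  have d13 := d 1 3 (by decide)
  have d14 := d 1 4 (by decide)
  have d15 := d 1 5 (by decide)
  have d16 := d 1 6 (by decide)
  have d17 := d 1 7 (by decide)
  have d18 := d 1 8 (by decide)
  have d19 := d 1 9 (by decide)
  have d23 := d 2 3 (by decide)
  have d29 := d 2 9 (by decide)
  have e123 := hC 1 2 3 (by decide)
  have e124 := hC 1 2 4 (by decide)
  have e125 := hC 1 2 5 (by decide)
  have e126 := hC 1 2 6 (by decide)
  have e127 := hC 1 2 7 (by decide)
  have e128 := hC 1 2 8 (by decide)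
  have e134 := hC 1 3 4 (by decide)
  have e135 := hC 1 3 5 (by decide)
  have e136 := hC 1 3 6 (by decide)
  have e137 := hC 1 3 7 (by decide)
  have e145 := hC 1 4 5 (by decide)
  have e146 := hC 1 4 6 (by decide)
  have e234 := hC 2 3 4 (by decide)
  have e235 := hC 2 3 5 (by decide)
  have e236 := hC 2 3 6 (by decide)
  have e245 := hC 2 4 5 (by decide)
  simp [coeff, Rg11, h01, h23, h29, h12, h13, h14, h15, h16, h17, h18, h19, h110, hs', hd]
    at d12 d13 d14 d15 d16 d17 d18 d19 d23 d29
      e123 e124 e125 e126 e127 e128 e134 e135 e136 e137 e145 e146 e234 e235 e236 e245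
  clear hs hs' d hC h1 hd
  have hi : i < 6 := by omega
  have hj : j < 12 := by omega
  interval_cases j <;> interval_cases i <;> first | assumption | omega | grind only

open GradedTable in
theorem Rg7_exists_eq_diagCoboundary (C : ℕ → ℕ → ℂ) (hs : ∀ i j, C i j = -C j i)
    (hC : Rg7.IsCocycle C) (h : C 1 6 = 0) :
    ∃ a, ∀ i j, i + j ≤ 7 → C i j = Rg7.diagCoboundary a i j :=
  exists_eq_diagCoboundary (T := Rg7) (by decide) Rg7_coeff_zero
    (fun j h2 hj => by
      have hj' : j < 6 := Nat.lt_of_succ_lt_succ hj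
      interval_cases j <;> simp [coeff, Rg7])
    (by simp [coeff, Rg7]) (by simp [coeff, Rg7]) (by simp [coeff, Rg7])
    (fun _ hs hD h01 h1 h23 h2n _ _ hij hle => Rg7_cocycle_eq_zero hs hD h01 h1 h23 h2n hij hle)
    C hs hC h

open GradedTable in
theorem Rg9_exists_eq_diagCoboundary (C : ℕ → ℕ → ℂ) (hs : ∀ i j, C i j = -C j i)
    (hC : Rg9.IsCocycle C) (h : C 1 8 = 0) :
    ∃ a, ∀ i j, i + j ≤ 9 → C i j = Rg9.diagCoboundary a i j :=
  exists_eq_diagCoboundary (T := Rg9) (by decide) Rg9_coeff_zero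
    (fun j h2 hj => by
      have hj' : j < 8 := Nat.lt_of_succ_lt_succ hj
      interval_cases j <;> simp [coeff, Rg9])
    (by simp [coeff, Rg9]) (by simp [coeff, Rg9]) (by simp [coeff, Rg9])
    (fun _ hs hD h01 h1 h23 h2n _ _ hij hle => Rg9_cocycle_eq_zero hs hD h01 h1 h23 h2n hij hle)
    C hs hC h

open GradedTable in
theorem Rg11_exists_eq_diagCoboundary (C : ℕ → ℕ → ℂ) (hs : ∀ i j, C i j = -C j i)
    (hC : Rg11.IsCocycle C) (h : C 1 10 = 0) :
    ∃ a, ∀ i j, i + j ≤ 11 → C i j = Rg11.diagCoboundary a i j :=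
  exists_eq_diagCoboundary (T := Rg11) (by decide) Rg11_coeff_zero
    (fun j h2 hj => by
      have hj' : j < 10 := Nat.lt_of_succ_lt_succ hj
      interval_cases j <;> simp [coeff, Rg11])
    (by simp [coeff, Rg11]) (by simp [coeff, Rg11]) (by simp [coeff, Rg11])
    (fun _ hs hD h01 h1 h23 h2n _ _ hij hle => Rg11_cocycle_eq_zero hs hD h01 h1 h23 h2n hij hle)
    C hs hC h

end

theorem mainTheorem10 :
    (∀ n : ℕ, 7 ≤ n →
      (∀ (R : Type*) [LieRing R] [LieAlgebra ℂ R], Nonempty (R ≃ₗ⁅ℂ⁆ (Rg3 n).Alg) →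
        Module.finrank ℂ (LieH2 ℂ R R) = 1) ∧
      (Rg3 n).cochain rg3Values ∈ twoCocycle ℂ (Rg3 n).Alg (Rg3 n).Alg ∧
      (Rg3 n).cochain rg3Values ∉ LinearMap.range (d₁₂ ℂ (Rg3 n).Alg (Rg3 n).Alg)) ∧
    ((∀ (R : Type*) [LieRing R] [LieAlgebra ℂ R], Nonempty (R ≃ₗ⁅ℂ⁆ Rg7.Alg) →
        Module.finrank ℂ (LieH2 ℂ R R) = 1) ∧
      Rg7.cochain rg7Values ∈ twoCocycle ℂ Rg7.Alg Rg7.Alg ∧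
      Rg7.cochain rg7Values ∉ LinearMap.range (d₁₂ ℂ Rg7.Alg Rg7.Alg)) ∧
    ((∀ (R : Type*) [LieRing R] [LieAlgebra ℂ R], Nonempty (R ≃ₗ⁅ℂ⁆ Rg9.Alg) →
        Module.finrank ℂ (LieH2 ℂ R R) = 1) ∧
      Rg9.cochain rg9Values ∈ twoCocycle ℂ Rg9.Alg Rg9.Alg ∧
      Rg9.cochain rg9Values ∉ LinearMap.range (d₁₂ ℂ Rg9.Alg Rg9.Alg)) ∧
    ((∀ (R : Type*) [LieRing R] [LieAlgebra ℂ R], Nonempty (R ≃ₗ⁅ℂ⁆ Rg11.Alg) →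
        Module.finrank ℂ (LieH2 ℂ R R) = 1) ∧
      Rg11.cochain rg11Values ∈ twoCocycle ℂ Rg11.Alg Rg11.Alg ∧
      Rg11.cochain rg11Values ∉ LinearMap.range (d₁₂ ℂ Rg11.Alg Rg11.Alg)) := by
  refine ⟨fun n hn => ?_, ?_, ?_, ?_⟩
  -- The detecting pair is `(v_1, v_2) = (e_1, e_n)`, with value in the line of `v_3 = e_2`.
  · exact GradedTable.finrank_LieH2_eq_one_and (Rg3_coeff_zero n) (rg3Values_isCocycle n) 1 2
      (by change 1 + 2 ≤ n; omega) (by simp [GradedTable.coeff, Rg3]) (by decide +kernel)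
      (Rg3_exists_eq_diagCoboundary hn)
  · exact GradedTable.finrank_LieH2_eq_one_and Rg7_coeff_zero rg7Values_isCocycle 1 6
      (by decide) (by simp [GradedTable.coeff, Rg7]) (by decide +kernel)
      Rg7_exists_eq_diagCoboundary
  · exact GradedTable.finrank_LieH2_eq_one_and Rg9_coeff_zero rg9Values_isCocycle 1 8
      (by decide) (by simp [GradedTable.coeff, Rg9]) (by decide +kernel)
      Rg9_exists_eq_diagCoboundary
  · exact GradedTable.finrank_LieH2_eq_one_and Rg11_coeff_zero rg11Values_isCocycle 1 10
      (by decide) (by simp [GradedTable.coeff, Rg11]) (by decide +kernel)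
      Rg11_exists_eq_diagCoboundary
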